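/- Let $(P_\theta)_{\theta\in\Theta}$ be a statistical model, let $H_{0,1},\dots,H_{0,n}\subseteq\Theta$ be null hypotheses, and let $p_1,\dots,p_n$ be $[0,1]$-valued p-values that are mutually independent under every $P_\theta$. Suppose that each $p_i$ is selectively dominant for $H_{0,i}$, i.e. for every $\theta\in H_{0,i}$: (a) $P_\theta(p_i\le t)\le t$ for all $t\in[0,1]$; (b) $p_i$ has a probability density function under $P_\theta$; and (c) for every measurable selection function $s:\mathbb{R}\to[0,1]$, $$P_\theta(p_i\le t\mid S=1)\le P(U\le t\mid S'=1)\qquad\text{for all } t\in[0,1],$$ where $U\sim\mathrm{Unif}([0,1])$ and $S,S'\in\{0,1\}$ are random variables with $P_\theta(S=1\mid p_i=x)=s(x)=P(S'=1\mid U=x)$ (a conditional probability given an event of probability zero is read as $0$). Let $p_{(1)}\le\dots\le p_{(n)}$ be the ordered p-values, with ties broken randomly (or in any other measurable way), set $p_{(n+1)}=1$, and let $H_{0,(j)}$ be the null hypothesis that belongs to $p_{(j)}$. Fix $1\le k\le n$ and $\alpha\in(0,1)$, let $J$ be the random set of the indices of the $k$ smallest p-values, and consider the test that rejects when $$-2\sum_{j=1}^k\log\left(\frac{p_{(j)}}{p_{(k+1)}}\right)\ge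 \mathrm{Quantile}(1-\alpha,\chi^2_{2k}),$$ where the left-hand side is read as $+\infty$ if $p_{(j)}=0$ for some $j\le k$. As a test of the data-dependent global null $\bigcap_{j=1}^k H_{0,(j)}=\bigcap_{i\in J}H_{0,i}$, it controls Type I error at level $\alpha$ conditionally on $J$, and hence also marginally: for every $\theta\in\Theta$ and every set $I$ of indices, $$P_\theta\Big(\theta\in\bigcap_{i\in J}H_{0,i}\text{ and the test rejects}\;\Big|\;J=I\Big)\le\alpha,\qquad P_\theta\Big(\theta\in\bigcap_{i\in J}H_{0,i}\text{ and the test rejects}\Big)\le\alpha.$$ The same holds for it as a test of the global null $\bigcap_{i=1}^nH_{0,i}$: for every $\theta\in\bigcap_{i=1}^nH_{0,i}$ and every $I$, $P_\theta(\text{the test rejects}\mid J=I)\le\alpha$ and $P_\theta(\text{the test rejects})\le\alpha$. -/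

import Mathlib

open MeasureTheory ProbabilityTheory Set

noncomputable section

namespace TopKFisher

/-- The uniform distribution on `[0, 1]`. -/
def unif : Measure ℝ := (volume : Measure ℝ).restrict (Icc 0 1)

/-- A selection function `s(x) = P(S = 1 | p = x)`: measurable with values in `[0, 1]`. -/
structure IsSelectionFunction (s : ℝ → ℝ) : Prop where
  measurable : Measurable s
  mem_Icc : ∀ x, s x ∈ Icc (0 : ℝ) 1

/-- The selection event `S = 1`: having observed the value `x`, we flip a coin that comes up heads
with probability `s x`. The coin flip is `v ≤ s x`, where `v` is uniform on `[0, 1]` and independent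
of the observed value. -/
def selected (s : ℝ → ℝ) : Set (ℝ × ℝ) := {y | y.2 ≤ s y.1}

/-- For a real random variable `X` with law `ν` and a selection indicator `S` with
`P(S = 1 | X = x) = s x`, this is the conditional probability `P(X ≤ t | S = 1)`.
It is `0` if `P(S = 1) = 0`. -/
def selectedCdf (ν : Measure ℝ) (s : ℝ → ℝ) (t : ℝ) : ENNReal :=
  cond (ν.prod unif) (selected s) {y | y.1 ≤ t}

/-- `p` is a selectively dominant p-value for the null hypothesis `H` in the statistical model
`(P θ)`. Under every distribution in the null, it is super-uniform, has a PDF, and,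
for every selection function, its conditional distribution given selection stochastically dominates
the conditional distribution of a uniform variable given the same selection. -/
structure IsSelectivelyDominant {Ω Θ : Type*} [MeasurableSpace Ω] (P : Θ → Measure Ω)
    (H : Set Θ) (p : Ω → ℝ) : Prop where
  measurable : Measurable p
  mem_Icc : ∀ ω, p ω ∈ Icc (0 : ℝ) 1
  valid : ∀ θ ∈ H, ∀ t ∈ Icc (0 : ℝ) 1, P θ {ω | p ω ≤ t} ≤ ENNReal.ofReal t
  hasPDF : ∀ θ ∈ H, HasPDF p (P θ) volume
  dominant : ∀ θ ∈ H, ∀ s : ℝ → ℝ, IsSelectionFunction s → ∀ t ∈ Icc (0 : ℝ) 1,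
    selectedCdf ((P θ).map p) s t ≤ selectedCdf unif s t

/-- `σ` is a (random) ranking of the p-values: `σ ω j` is the index of the p-value of rank `j`,
ranks being counted from `0`. Ties may be broken in any measurable way, in particular by
randomization that is carried by `Ω`. -/
structure IsRanking {Ω : Type*} [MeasurableSpace Ω] {n : ℕ} (p : Fin n → Ω → ℝ)
    (σ : Ω → Equiv.Perm (Fin n)) : Prop where
  measurable : ∀ τ : Equiv.Perm (Fin n), MeasurableSet {ω | σ ω = τ}
  monotone : ∀ ω, Monotone fun j : Fin n => p (σ ω j) ω

/-- The ordered p-values, with ranks counted from `0`: `orderedP p σ j ω` is `p_(j+1)`, with the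
convention `p_(n+1) = 1`. -/
def orderedP {Ω : Type*} {n : ℕ} (p : Fin n → Ω → ℝ) (σ : Ω → Equiv.Perm (Fin n))
    (j : ℕ) (ω : Ω) : ℝ :=
  if h : j < n then p (σ ω ⟨j, h⟩) ω else 1

/-- The random set of the indices of the `k` smallest p-values. -/
def bottom {Ω : Type*} {n : ℕ} (σ : Ω → Equiv.Perm (Fin n)) (k : ℕ) (ω : Ω) : Finset (Fin n) :=
  Finset.univ.filter fun i => ((σ ω).symm i : ℕ) < k

/-- The chi-squared distribution with `d` degrees of freedom: the Gamma distribution with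
shape `d / 2` and rate `1 / 2`. -/
def chiSquared (d : ℕ) : Measure ℝ := gammaMeasure ((d : ℝ) / 2) (1 / 2)

/-- The `q`-quantile of a distribution on `ℝ`, for `0 < q < 1`. -/
def quantile (q : ℝ) (μ : Measure ℝ) : ℝ := sInf {x | q ≤ cdf μ x}

/-- The test statistic `-2 ∑_{j ≤ k} log (p_(j) / p_(k+1))`. -/
def statistic {Ω : Type*} {n : ℕ} (p : Fin n → Ω → ℝ) (σ : Ω → Equiv.Perm (Fin n))
    (k : ℕ) (ω : Ω) : ℝ :=
  -2 * ∑ j ∈ Finset.range k, Real.log (orderedP p σ j ω / orderedP p σ k ω)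

/-- The event that the level `α` top-`k` test rejects. If one of the `k` smallest p-values is `0`,
the statistic is read as `+∞` (as `log 0 = -∞`), so the test rejects. -/
def rejects {Ω : Type*} {n : ℕ} (p : Fin n → Ω → ℝ) (σ : Ω → Equiv.Perm (Fin n))
    (k : ℕ) (α : ℝ) : Set Ω :=
  {ω | (∃ j < k, orderedP p σ j ω = 0) ∨
    quantile (1 - α) (chiSquared (2 * k)) ≤ statistic p σ k ω}

/-- The event that, when `θ` is the truth, the data-dependent global null over the `k` smallest
p-values is falsely rejected. -/
def falselyRejects {Ω Θ : Type*} {n : ℕ} (H : Fin n → Set Θ) (p : Fin n → Ω → ℝ)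
    (σ : Ω → Equiv.Perm (Fin n)) (k : ℕ) (α : ℝ) (θ : Θ) : Set Ω :=
  {ω | θ ∈ ⋂ i ∈ bottom σ k ω, H i} ∩ rejects p σ k α

end TopKFisher

end

namespace TopKFisher

/-! Fix a set `I` of `k` indices whose nulls all contain `θ`, and let `M` be the smallest p-value
outside `I`, read as `1` if there is none. Up to ties, which are null events because the p-values in
`I` have densities, the event `J = I` says that every p-value in `I` is at most `M`; on it, `M` is
the denominator `p_(k+1)` of the statistic. Since `M` is independent of the p-values in `I`, it can
be frozen at a value `y`. Selective dominance for the selection function `1_{x ≤ y}` says that `p_i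
/ y`, given `p_i ≤ y`, is stochastically larger than a uniform variable
(`IsSelectivelyDominant.measure_le_mul`). Hence the product of these ratios dominates a product of
`k` independent uniforms (`measure_prod_le_prodTail`), and `-2 log` of the latter is chi-squared
with `2k` degrees of freedom (`prodTail_exp_quantile_le`). Integrating over `y` gives `P(J = I,
reject) ≤ α P(J = I)`. Division gives the conditional bound and summation over `I` the marginal one.
If some null in `I` is false, no false rejection occurs on `J = I`. -/

/-! ### Products of independent uniform variables -/

/-- The probability that a product of `k` independent uniform variables is at most `r`. -/
noncomputable def prodTail : ℕ → ℝ → ENNReal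
  | 0, r => if 1 ≤ r then 1 else 0
  | k + 1, r => ∫⁻ u in Ioc (0 : ℝ) 1, prodTail k (r / u)

lemma prodTail_mono (k : ℕ) : Monotone (prodTail k) := by
  induction k with
  | zero =>
    intro a b hab
    simp only [prodTail]
    split_ifs with h1 h2
    · exact le_rfl
    · exact absurd (h1.trans hab) h2
    · exact zero_le_one
    · exact le_rfl
  | succ k ih =>
    intro a b hab
    exact setLIntegral_mono' measurableSet_Ioc fun u hu => ih (by gcongr; exact hu.1.le)

lemma prodTail_le_one (k : ℕ) (r : ℝ) : prodTail k r ≤ 1 := by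
  induction k generalizing r with
  | zero => simp only [prodTail]; split_ifs <;> simp
  | succ k ih =>
    calc prodTail (k + 1) r ≤ ∫⁻ _ in Ioc (0 : ℝ) 1, 1 := lintegral_mono fun u => ih _
      _ = 1 := by simp

lemma prodTail_of_one_le (k : ℕ) {r : ℝ} (hr : 1 ≤ r) : prodTail k r = 1 := by
  induction k generalizing r with
  | zero => simp [prodTail, hr]
  | succ k ih =>
    have : ∫⁻ u in Ioc (0 : ℝ) 1, prodTail k (r / u) = ∫⁻ _ in Ioc (0 : ℝ) 1, 1 :=
      setLIntegral_congr_fun measurableSet_Ioc fun u hu =>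
        ih ((one_le_div hu.1).2 (hu.2.trans hr))
    simp [prodTail, this]

/-- As `-log (r / u)` has derivative `1 / u` in `u`, each summand integrates to the next power. The
boundary term at `u = r` vanishes because `log 1 = 0`. -/
lemma integral_div_mul_sum_pow_log (k : ℕ) {r : ℝ} (h0 : 0 < r) (h1 : r ≤ 1) :
    ∫ u in r..1, (r / u) * ∑ j ∈ Finset.range k, (-Real.log (r / u)) ^ j / j.factorial =
      r * ∑ j ∈ Finset.range k, (-Real.log r) ^ (j + 1) / (j + 1).factorial := by
  have hpos : ∀ u ∈ uIcc r 1, 0 < u := fun u hu => by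
    rw [uIcc_of_le h1] at hu; exact h0.trans_le hu.1
  rw [intervalIntegral.integral_eq_sub_of_hasDerivAt
    (f := fun u => r * ∑ j ∈ Finset.range k,
      (-Real.log (r / u)) ^ (j + 1) / (j + 1).factorial)]
  · simp [div_self h0.ne']
  · intro u hu
    have hu := hpos u hu
    have hl : HasDerivAt (fun u => -Real.log (r / u)) (1 / u) u := by
      have h2 : HasDerivAt (fun u => r / u) (-r / u ^ 2) u := by
        simpa [div_eq_mul_inv, mul_comm] using (hasDerivAt_inv hu.ne').const_mul r
      refine (h2.log (div_pos h0 hu).ne').neg.congr_deriv ?_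
      have := h0.ne'
      have := hu.ne'
      field_simp
    rw [show (r / u * ∑ j ∈ Finset.range k, (-Real.log (r / u)) ^ j / j.factorial) =
      r * ∑ j ∈ Finset.range k, (((j + 1 : ℕ) : ℝ) * (-Real.log (r / u)) ^ j * (1 / u)) /
        (j + 1).factorial by
      rw [div_mul_eq_mul_div, mul_div_assoc, Finset.sum_div]
      congr 1
      refine Finset.sum_congr rfl fun j _ => ?_
      rw [Nat.factorial_succ]
      push_cast
      field_simp]
    refine HasDerivAt.const_mul r (HasDerivAt.fun_sum fun j _ => ?_)
    exact ((hl.pow (j + 1)).div_const _)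
  · apply ContinuousOn.intervalIntegrable
    have hd : ContinuousOn (fun u => r / u) (uIcc r 1) :=
      continuousOn_const.div continuousOn_id fun u hu => (hpos u hu).ne'
    refine hd.mul (continuousOn_finsetSum _ fun j _ => ?_)
    exact ((hd.log fun u hu => (div_pos h0 (hpos u hu)).ne').neg.pow j).div_const _

lemma mul_sum_pow_log_nonneg (k : ℕ) {r : ℝ} (h0 : 0 ≤ r) (h1 : r ≤ 1) :
    0 ≤ r * ∑ j ∈ Finset.range k, (-Real.log r) ^ j / j.factorial := by
  have := neg_nonneg.2 (Real.log_nonpos h0 h1)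
  positivity

/-- Induction on the number of factors, splitting the new factor `u` at `r`: values `u ≤ r`
contribute the `j = 0` term, and values `u > r` raise each old power of the logarithm by one. -/
lemma prodTail_of_mem_Ioo (k : ℕ) {r : ℝ} (hr : r ∈ Ioo (0 : ℝ) 1) :
    prodTail k r =
      ENNReal.ofReal (r * ∑ j ∈ Finset.range k, (-Real.log r) ^ j / j.factorial) := by
  induction k generalizing r with
  | zero => simp [prodTail, hr.2]
  | succ k ih =>
    obtain ⟨h0, h1⟩ := hr
    have hlow : ∫⁻ u in Ioc 0 r, prodTail k (r / u) = ENNReal.ofReal r := by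
      rw [setLIntegral_congr_fun (g := fun _ => 1) measurableSet_Ioc fun u hu =>
        prodTail_of_one_le k ((one_le_div hu.1).2 hu.2)]
      simp
    have hpt : ∀ u ∈ Ioc r 1, prodTail k (r / u) = ENNReal.ofReal
        ((r / u) * ∑ j ∈ Finset.range k, (-Real.log (r / u)) ^ j / j.factorial) := fun u hu =>
      ih ⟨div_pos h0 (h0.trans hu.1), (div_lt_one (h0.trans hu.1)).2 hu.1⟩
    have hcont : ContinuousOn (fun u => (r / u) * ∑ j ∈ Finset.range k,
        (-Real.log (r / u)) ^ j / j.factorial) (Icc r 1) := by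
      have hpos : ∀ u ∈ Icc r 1, 0 < u := fun u hu => h0.trans_le hu.1
      have hd : ContinuousOn (fun u => r / u) (Icc r 1) :=
        continuousOn_const.div continuousOn_id fun u hu => (hpos u hu).ne'
      refine hd.mul (continuousOn_finsetSum _ fun j _ => ?_)
      exact ((hd.log fun u hu => (div_pos h0 (hpos u hu)).ne').neg.pow j).div_const _
    have hhigh : ∫⁻ u in Ioc r 1, prodTail k (r / u) = ENNReal.ofReal
        (r * ∑ j ∈ Finset.range k, (-Real.log r) ^ (j + 1) / (j + 1).factorial) := by
      rw [setLIntegral_congr_fun measurableSet_Ioc hpt, ← ofReal_integral_eq_lintegral_ofReal,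
        ← intervalIntegral.integral_of_le h1.le, integral_div_mul_sum_pow_log k h0 h1.le]
      · exact (hcont.integrableOn_Icc).mono_set Ioc_subset_Icc_self
      · refine (ae_restrict_iff' measurableSet_Ioc).2 (ae_of_all _ fun u hu => ?_)
        exact mul_sum_pow_log_nonneg k (div_nonneg h0.le (h0.trans hu.1).le)
          ((div_le_one (h0.trans hu.1)).2 hu.1.le)
    rw [prodTail, ← Ioc_union_Ioc_eq_Ioc h0.le h1.le,
      lintegral_union measurableSet_Ioc (Ioc_disjoint_Ioc_of_le le_rfl), hlow, hhigh,
      ← ENNReal.ofReal_add h0.le, Finset.sum_range_succ']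
    · congr 1
      simp
      ring
    · have := neg_nonneg.2 (Real.log_nonpos h0.le h1.le)
      positivity

/-! ### The chi-squared tail and its quantile -/

lemma hasDerivAt_exp_mul_sum_pow (k : ℕ) (x : ℝ) :
    HasDerivAt (fun x : ℝ => Real.exp (-(1 / 2 * x)) *
      ∑ j ∈ Finset.range (k + 1), (1 / 2 * x) ^ j / j.factorial)
      (-(1 / 2 * (Real.exp (-(1 / 2 * x)) * ((1 / 2 * x) ^ k / k.factorial)))) x := by
  have hl : HasDerivAt (fun x : ℝ => 1 / 2 * x) (1 / 2) x := by
    simpa using (hasDerivAt_id x).const_mul (1 / 2 : ℝ)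
  have he := hl.fun_neg.exp
  induction k with
  | zero => simpa [mul_comm] using he
  | succ k ih =>
    have ht := ih.add (he.mul ((hl.fun_pow (k + 1)).div_const ((k + 1).factorial : ℝ)))
    refine (ht.congr_deriv ?_).congr_of_eventuallyEq (Filter.Eventually.of_forall fun y => ?_)
    · rw [Nat.factorial_succ]
      push_cast
      field_simp
      simp
    · simp only [Pi.add_apply, Pi.mul_apply]
      rw [Finset.sum_range_succ _ (k + 1), mul_add]

/-- The sum telescopes under differentiation to minus the Gamma density with integer shape `k`. At
`r = exp (-c / 2)` it is the closed form of `prodTail`. -/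
lemma chiSquared_Ioi {k : ℕ} (hk : 1 ≤ k) {c : ℝ} (hc : 0 ≤ c) :
    chiSquared (2 * k) (Ioi c) = ENNReal.ofReal (Real.exp (-(1 / 2 * c)) *
      ∑ j ∈ Finset.range k, (1 / 2 * c) ^ j / j.factorial) := by
  obtain ⟨k, rfl⟩ := Nat.exists_eq_add_of_le' hk
  have hderiv : ∀ x ∈ Ioi c, HasDerivAt (fun x : ℝ => -(Real.exp (-(1 / 2 * x)) *
      ∑ j ∈ Finset.range (k + 1), (1 / 2 * x) ^ j / j.factorial))
      (1 / 2 * (Real.exp (-(1 / 2 * x)) * ((1 / 2 * x) ^ k / k.factorial))) x := fun x _ => by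
    simpa using (hasDerivAt_exp_mul_sum_pow k x).fun_neg
  have hcont : ContinuousWithinAt (fun x : ℝ => -(Real.exp (-(1 / 2 * x)) *
      ∑ j ∈ Finset.range (k + 1), (1 / 2 * x) ^ j / j.factorial)) (Ici c) c :=
    (hasDerivAt_exp_mul_sum_pow k c).fun_neg.continuousAt.continuousWithinAt
  have hnn : ∀ x ∈ Ioi c,
      0 ≤ 1 / 2 * (Real.exp (-(1 / 2 * x)) * ((1 / 2 * x) ^ k / k.factorial)) := fun x hx => by
    have : 0 ≤ x := hc.trans (le_of_lt hx)
    positivity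
  have hlim : Filter.Tendsto (fun x : ℝ => -(Real.exp (-(1 / 2 * x)) *
      ∑ j ∈ Finset.range (k + 1), (1 / 2 * x) ^ j / j.factorial)) Filter.atTop (nhds 0) := by
    have hl : Filter.Tendsto (fun x : ℝ => 1 / 2 * x) Filter.atTop Filter.atTop :=
      Filter.tendsto_id.const_mul_atTop (by norm_num)
    have : Filter.Tendsto (fun x : ℝ => -∑ j ∈ Finset.range (k + 1),
        ((1 / 2 * x) ^ j * Real.exp (-(1 / 2 * x))) / j.factorial) Filter.atTop
        (nhds (-∑ j ∈ Finset.range (k + 1), 0 / (j.factorial : ℝ))) :=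
      (tendsto_finsetSum _ fun j _ =>
        ((Real.tendsto_pow_mul_exp_neg_atTop_nhds_zero j).comp hl).div_const _).neg
    simp only [zero_div, Finset.sum_const_zero, neg_zero] at this
    refine this.congr fun x => ?_
    rw [Finset.mul_sum]
    congr 1
    exact Finset.sum_congr rfl fun j _ => by ring
  rw [chiSquared, gammaMeasure, withDensity_apply _ measurableSet_Ioi,
    setLIntegral_congr_fun (g := fun x => ENNReal.ofReal
      (1 / 2 * (Real.exp (-(1 / 2 * x)) * ((1 / 2 * x) ^ k / k.factorial)))) measurableSet_Ioi,
    ← ofReal_integral_eq_lintegral_ofReal,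
    integral_Ioi_of_hasDerivAt_of_nonneg hcont hderiv hnn hlim]
  · simp
  · exact integrableOn_Ioi_deriv_of_nonneg hcont hderiv hnn hlim
  · exact (ae_restrict_iff' measurableSet_Ioi).2 (ae_of_all _ hnn)
  · intro x hx
    have hx : 0 ≤ x := hc.trans (le_of_lt hx)
    have e : ((2 * (k + 1) : ℕ) : ℝ) / 2 = k + 1 := by push_cast; ring
    simp only [gammaPDF_of_nonneg hx]
    congr 1
    rw [e, Real.Gamma_nat_eq_factorial, add_sub_cancel_right, Real.rpow_natCast, mul_pow,
      show ((k : ℝ) + 1) = ((k + 1 : ℕ) : ℝ) by push_cast; rfl, Real.rpow_natCast, pow_succ]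
    ring

lemma isProbabilityMeasure_chiSquared {k : ℕ} (hk : 1 ≤ k) :
    IsProbabilityMeasure (chiSquared (2 * k)) := by
  have : (0 : ℝ) < k := by exact_mod_cast hk
  exact isProbabilityMeasure_gammaMeasure (by push_cast; linarith) (by norm_num)

/-- The inequality holds at every point above the infimum and passes to the limit by right
continuity. -/
lemma le_cdf_quantile {μ : Measure ℝ} {q : ℝ} (hq : q ∈ Ioo (0 : ℝ) 1) :
    q ≤ cdf μ (quantile q μ) := by
  have hne : {x | q ≤ cdf μ x}.Nonempty :=
    ((tendsto_cdf_atTop μ).eventually (eventually_ge_nhds hq.2)).exists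
  refine ge_of_tendsto (((cdf μ).right_continuous (quantile q μ)).tendsto.mono_left
    (nhdsWithin_mono _ Ioi_subset_Ici_self)) ?_
  filter_upwards [self_mem_nhdsWithin] with y hy
  obtain ⟨x, hx, hxy⟩ := exists_lt_of_csInf_lt hne hy
  exact le_trans hx (monotone_cdf μ hxy.le)

/-- All the mass lies on `(0, ∞)`. Positivity puts `exp (-c / 2)` in `(0, 1)`, where the closed form
of `prodTail` holds. -/
lemma quantile_chiSquared_pos {k : ℕ} (hk : 1 ≤ k) {q : ℝ} (hq : q ∈ Ioo (0 : ℝ) 1) :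
    0 < quantile q (chiSquared (2 * k)) := by
  have := isProbabilityMeasure_chiSquared hk
  by_contra! h
  have h1 := (le_cdf_quantile (μ := chiSquared (2 * k)) hq).trans (monotone_cdf _ h)
  have h2 := chiSquared_Ioi hk le_rfl
  obtain ⟨k, rfl⟩ := Nat.exists_eq_add_of_le' hk
  rw [Finset.sum_range_succ'] at h2
  simp only [mul_zero, neg_zero, Real.exp_zero, one_mul, pow_succ, zero_div, Finset.sum_const_zero,
    pow_zero, Nat.factorial_zero, Nat.cast_one, div_one, zero_add, ENNReal.ofReal_one] at h2
  have h3 : chiSquared (2 * (k + 1)) (Iic 0) = 0 := by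
    rw [← compl_Ioi, prob_compl_eq_one_sub measurableSet_Ioi, h2, tsub_self]
  rw [cdf_eq_real, measureReal_def, h3] at h1
  exact absurd h1 (by simpa using hq.1)

/-- The chi-squared critical value, on the scale of products of uniform variables. -/
lemma prodTail_exp_quantile_le {k : ℕ} (hk : 1 ≤ k) {α : ℝ} (hα : α ∈ Ioo (0 : ℝ) 1) :
    prodTail k (Real.exp (-(1 / 2 * quantile (1 - α) (chiSquared (2 * k))))) ≤
      ENNReal.ofReal α := by
  have := isProbabilityMeasure_chiSquared hk
  have hq : 1 - α ∈ Ioo (0 : ℝ) 1 := ⟨by linarith [hα.2], by linarith [hα.1]⟩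
  set c := quantile (1 - α) (chiSquared (2 * k)) with hc
  have hpos : 0 < c := quantile_chiSquared_pos hk hq
  have hcdf : 1 - α ≤ cdf (chiSquared (2 * k)) c := le_cdf_quantile hq
  rw [prodTail_of_mem_Ioo k ⟨Real.exp_pos _, Real.exp_lt_one_iff.2 (by linarith)⟩, Real.log_exp,
    neg_neg, ← chiSquared_Ioi hk hpos.le, ← compl_Iic, prob_compl_eq_one_sub measurableSet_Iic,
    ← ofReal_cdf, ← ENNReal.ofReal_one, ← ENNReal.ofReal_sub _ (cdf_nonneg _ _)]
  exact ENNReal.ofReal_le_ofReal (by linarith)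

/-! ### Stochastic domination of products -/

/-- If `ν`, conditionally on `(-∞, m]`, dominates the uniform distribution on `[0, m]`,
then it gives smaller expectations to antitone functions. -/
lemma setLIntegral_div_le_of_antitoneOn {ν : Measure ℝ} {m : ℝ} (hm : 0 < m)
    (hν : ∀ t ∈ Icc (0 : ℝ) 1, ν (Iic (t * m)) ≤ ENNReal.ofReal t * ν (Iic m))
    {f : ℝ → ENNReal} (hf : AntitoneOn f (Ioi 0)) (hfm : Measurable f) (hf1 : ∀ x, f x ≤ 1) :
    ∫⁻ y in Ioc 0 m, f (y / m) ∂ν ≤ ν (Iic m) * ∫⁻ u in Ioc (0 : ℝ) 1, f u := by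
  have hfin : ∀ x, f x ≠ ⊤ := fun x => ((hf1 x).trans_lt ENNReal.one_lt_top).ne
  have hgm : Measurable fun x => (f x).toReal := hfm.ennreal_toReal
  have hsup : Measurable fun a : ℝ =>
      volume.restrict (Ioc (0 : ℝ) 1) {u | a < (f u).toReal} :=
    Antitone.measurable fun a b hab => measure_mono fun u (hu : b < _) => hab.trans_lt hu
  have hdiv : Measurable fun y : ℝ => y / m := measurable_id.div_const m
  have e1 : ∫⁻ y in Ioc 0 m, f (y / m) ∂ν =
      ∫⁻ a in Ioi (0 : ℝ), ν.restrict (Ioc 0 m) {y | a < (f (y / m)).toReal} := by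
    rw [← lintegral_eq_lintegral_meas_lt _ (ae_of_all _ fun _ => ENNReal.toReal_nonneg)
      (show Measurable fun y => (f (y / m)).toReal from hgm.comp hdiv).aemeasurable]
    simp [ENNReal.ofReal_toReal (hfin _)]
  have e2 : ∫⁻ u in Ioc (0 : ℝ) 1, f u =
      ∫⁻ a in Ioi (0 : ℝ), volume.restrict (Ioc (0 : ℝ) 1) {u | a < (f u).toReal} := by
    rw [← lintegral_eq_lintegral_meas_lt _ (ae_of_all _ fun _ => ENNReal.toReal_nonneg)
      hgm.aemeasurable]
    simp [ENNReal.ofReal_toReal (hfin _)]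
  -- By the layer-cake formula it suffices to compare superlevel sets. For antitone `f` these are
  -- initial segments of `(0, 1]`, so each lies below its own length, and `hν` applies with `t`
  -- equal to that length.
  rw [e1, e2, ← lintegral_const_mul _ hsup]
  refine lintegral_mono fun a => ?_
  have hT : MeasurableSet {u | a < (f u).toReal} := measurableSet_lt measurable_const hgm
  rw [Measure.restrict_apply hT,
    Measure.restrict_apply (show MeasurableSet {y | a < (f (y / m)).toReal} from
      measurableSet_lt measurable_const (hgm.comp hdiv))]
  set T := {u | a < (f u).toReal} ∩ Ioc (0 : ℝ) 1 with hTdef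
  have hT1 : volume T ≤ 1 := (measure_mono inter_subset_right).trans (by simp)
  have hTtop : volume T ≠ ⊤ := (hT1.trans_lt ENNReal.one_lt_top).ne
  have hle : ∀ u ∈ T, u ≤ (volume T).toReal := fun u hu => by
    have hsub : Ioc 0 u ⊆ T := fun v hv =>
      ⟨lt_of_lt_of_le hu.1 (ENNReal.toReal_mono (hfin v) (hf hv.1 hu.2.1 hv.2)),
        hv.1, hv.2.trans hu.2.2⟩
    have := measure_mono (μ := volume) hsub
    rw [Real.volume_Ioc, sub_zero] at this
    exact (ENNReal.ofReal_le_iff_le_toReal hTtop).1 this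
  have hsub : {y | a < (f (y / m)).toReal} ∩ Ioc 0 m ⊆ Iic ((volume T).toReal * m) :=
    fun y hy => (div_le_iff₀ hm).1
      (hle (y / m) ⟨hy.1, div_pos hy.2.1 hm, (div_le_one hm).2 hy.2.2⟩)
  refine (measure_mono hsub).trans ((hν _ ⟨ENNReal.toReal_nonneg, ?_⟩).trans ?_)
  · simpa using ENNReal.toReal_mono ENNReal.one_ne_top hT1
  · rw [ENNReal.ofReal_toReal hTtop, mul_comm]

lemma _root_.ProbabilityTheory.IndepFun.measure_setOf_eq_lintegral {Ω α β : Type*}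
    [MeasurableSpace Ω] [MeasurableSpace α] [MeasurableSpace β] {μ : Measure Ω}
    [IsFiniteMeasure μ] {X : Ω → α} {Y : Ω → β} (h : IndepFun X Y μ) (hX : Measurable X)
    (hY : Measurable Y) {S : Set (α × β)} (hS : MeasurableSet S) :
    μ {ω | (X ω, Y ω) ∈ S} = ∫⁻ y, μ {ω | (X ω, y) ∈ S} ∂(μ.map Y) := by
  have h1 : μ {ω | (X ω, Y ω) ∈ S} = μ.map (fun ω => (X ω, Y ω)) S := by
    rw [Measure.map_apply (hX.prodMk hY) hS]; rfl
  rw [h1, (indepFun_iff_map_prod_eq_prod_map_map hX.aemeasurable hY.aemeasurable).1 h,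
    Measure.prod_apply_symm hS]
  refine lintegral_congr fun y => ?_
  rw [Measure.map_apply hX (hS.preimage measurable_prodMk_right)]
  rfl

/-- Independent variables that, given that they are at most `m`, dominate the uniform distribution
on `[0, m]`, have a product that dominates the product of as many uniform variables. -/
lemma measure_prod_le_prodTail {Ω ι : Type*} [MeasurableSpace Ω] [DecidableEq ι]
    {μ : Measure Ω} [IsProbabilityMeasure μ] {X : ι → Ω → ℝ} (hX : ∀ i, Measurable (X i))
    (hind : iIndepFun X μ) {m : ℝ} (hm : 0 < m) (s : Finset ι)
    (hs : ∀ i ∈ s, ∀ t ∈ Icc (0 : ℝ) 1,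
      μ {ω | X i ω ≤ t * m} ≤ ENNReal.ofReal t * μ {ω | X i ω ≤ m}) {r : ℝ} (hr : 0 ≤ r) :
    μ {ω | (∀ i ∈ s, X i ω ≤ m) ∧ ∏ i ∈ s, X i ω ≤ r * m ^ s.card} ≤
      (∏ i ∈ s, μ {ω | X i ω ≤ m}) * prodTail s.card r := by
  induction s using Finset.induction_on generalizing r with
  | empty =>
    by_cases h : 1 ≤ r <;> simp [prodTail, h]
  | insert a s ha ih =>
    have ih := fun {r : ℝ} (hr : 0 ≤ r) =>
      ih (fun i hi => hs i (Finset.mem_insert_of_mem hi)) (r := r) hr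
    have hsa := hs a (Finset.mem_insert_self a s)
    have hmap : ∀ t, (μ.map (X a)) (Iic t) = μ {ω | X a ω ≤ t} := fun t => by
      rw [Measure.map_apply (hX a) measurableSet_Iic]; rfl
    have hi : IndepFun (fun ω (i : s) => X i ω) (X a) μ :=
      (hind.indepFun_finset s {a} (by simpa using ha) hX).comp measurable_id
        (measurable_pi_apply (⟨a, Finset.mem_singleton_self a⟩ : ({a} : Finset ι)))
    let S : Set ((s → ℝ) × ℝ) :=
      {z | (∀ i, z.1 i ≤ m) ∧ z.2 ≤ m ∧ z.2 * ∏ i, z.1 i ≤ r * m ^ (s.card + 1)}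
    have hS : MeasurableSet S := by
      refine MeasurableSet.inter ?_ (MeasurableSet.inter ?_ ?_)
      · change MeasurableSet {z : (s → ℝ) × ℝ | ∀ i, z.1 i ≤ m}
        rw [ofPred_forall]
        exact MeasurableSet.iInter fun i => measurableSet_le
          ((measurable_pi_apply i).comp measurable_fst) measurable_const
      · exact measurableSet_le measurable_snd measurable_const
      · refine measurableSet_le (measurable_snd.mul (Finset.measurable_prod _ fun i _ => ?_))
          measurable_const
        exact (measurable_pi_apply i).comp measurable_fst
    have hset : {ω | (∀ i ∈ insert a s, X i ω ≤ m) ∧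
        ∏ i ∈ insert a s, X i ω ≤ r * m ^ (insert a s).card} =
        {ω | ((fun i : s => X i ω), X a ω) ∈ S} := by
      ext ω
      simp only [S, mem_ofPred_eq, Finset.card_insert_of_notMem ha, Finset.prod_insert ha,
        Finset.forall_mem_insert, Subtype.forall, Finset.prod_coe_sort s fun i => X i ω]
      tauto
    -- The case `t = 0` of the hypothesis excludes mass on `(-∞, 0]`.
    have hpos : ∀ᵐ y ∂(μ.map (X a)), 0 < y := by
      rw [ae_iff]
      have : (μ.map (X a)) (Iic 0) = 0 := by
        have := hsa 0 (by simp)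
        rw [hmap]
        simpa using this
      simpa [Iic] using this
    -- With the new factor frozen at `y`, the threshold for the others becomes `r / (y / m)`, as in
    -- the recursion for `prodTail`.
    have hsec : ∀ᵐ y ∂(μ.map (X a)), μ {ω | ((fun i : s => X i ω), y) ∈ S} ≤
        (Ioc 0 m).indicator (fun y => (∏ i ∈ s, μ {ω | X i ω ≤ m}) *
          prodTail s.card (r / (y / m))) y := by
      filter_upwards [hpos] with y hy
      by_cases hym : y ≤ m
      · rw [indicator_of_mem (show y ∈ Ioc 0 m from ⟨hy, hym⟩)]
        refine (measure_mono fun ω hω => ?_).trans (ih (r := r / (y / m)) (by positivity))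
        obtain ⟨h1, -, h2⟩ := hω
        refine ⟨fun i hi => h1 ⟨i, hi⟩, ?_⟩
        simp only [Finset.prod_coe_sort s fun i => X i ω] at h2
        rw [show r / (y / m) * m ^ s.card = r * m ^ (s.card + 1) / y by field_simp; ring,
          le_div_iff₀ hy, mul_comm]
        exact h2
      · have : {ω | ((fun i : s => X i ω), y) ∈ S} = ∅ := by
          ext ω; simp [S, hym]
        simp [this]
    have hmeas : Measurable fun u => prodTail s.card (r / u) :=
      (prodTail_mono _).measurable.comp (measurable_const.div measurable_id)
    have hdom := setLIntegral_div_le_of_antitoneOn (ν := μ.map (X a)) hm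
      (fun t ht => by rw [hmap, hmap]; exact hsa t ht)
      (f := fun u => prodTail s.card (r / u))
      (fun u hu v hv huv => prodTail_mono _ (div_le_div_of_nonneg_left hr hu huv))
      hmeas (fun _ => prodTail_le_one _ _)
    have hmeas' : Measurable fun y => prodTail s.card (r / (y / m)) :=
      hmeas.comp (measurable_id.div_const m)
    calc _ = ∫⁻ y, μ {ω | ((fun i : s => X i ω), y) ∈ S} ∂(μ.map (X a)) := by
          rw [hset]
          exact hi.measure_setOf_eq_lintegral (measurable_pi_lambda _ fun i => hX i) (hX a) hS
      _ ≤ _ := lintegral_mono_ae hsec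
      _ = (∏ i ∈ s, μ {ω | X i ω ≤ m}) *
          ∫⁻ y in Ioc 0 m, prodTail s.card (r / (y / m)) ∂(μ.map (X a)) := by
          rw [lintegral_indicator measurableSet_Ioc,
            lintegral_const_mul _ hmeas']
      _ ≤ _ := by
          rw [Finset.prod_insert ha, Finset.card_insert_of_notMem ha, mul_comm (μ _), mul_assoc,
            ← hmap m]
          exact mul_le_mul_right hdom _

/-! ### Selective dominance under truncation -/

lemma unif_Iic {t : ℝ} (ht : t ∈ Icc (0 : ℝ) 1) : unif (Iic t) = ENNReal.ofReal t := by
  rw [unif, Measure.restrict_apply measurableSet_Iic,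
    show Iic t ∩ Icc 0 1 = Icc 0 t by
      ext x; exact ⟨fun h => ⟨h.2.1, h.1⟩, fun h => ⟨h.2, h.1, h.2.trans ht.2⟩⟩]
  simp

/-- With a 0-1 selection function the coin is deterministic almost surely: for `x > m` it can
succeed only if `v ≤ 0`, a null event. -/
lemma unif_prod_selected_inter {ν : Measure ℝ} [SFinite ν] (m : ℝ) {B : Set ℝ}
    (hB : MeasurableSet B) :
    (ν.prod unif) (selected ((Iic m).indicator 1) ∩ Prod.fst ⁻¹' B) = ν (Iic m ∩ B) := by
  have hs : Measurable ((Iic m).indicator (1 : ℝ → ℝ)) :=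
    measurable_one.indicator measurableSet_Iic
  have hsel : MeasurableSet (selected ((Iic m).indicator 1)) :=
    measurableSet_le measurable_snd (hs.comp measurable_fst)
  have : SFinite unif := by unfold unif; infer_instance
  rw [Measure.prod_apply (hsel.inter (measurable_fst hB)),
    ← lintegral_indicator_one (measurableSet_Iic.inter hB)]
  refine lintegral_congr fun x => ?_
  by_cases hxB : x ∈ B
  · by_cases hx : x ≤ m
    · have : Prod.mk x ⁻¹' (selected ((Iic m).indicator 1) ∩ Prod.fst ⁻¹' B) = Iic (1 : ℝ) := by
        ext v; simp [selected, hxB, hx]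
      rw [this, unif_Iic (by simp)]
      simp [hxB, hx]
    · have : Prod.mk x ⁻¹' (selected ((Iic m).indicator 1) ∩ Prod.fst ⁻¹' B) = Iic (0 : ℝ) := by
        ext v; simp [selected, hxB, hx]
      rw [this, unif_Iic (by simp)]
      simp [hx]
  · have : Prod.mk x ⁻¹' (selected ((Iic m).indicator 1) ∩ Prod.fst ⁻¹' B) = ∅ := by
      ext v; simp [hxB]
    simp [this, hxB]

lemma selectedCdf_indicator_Iic {ν : Measure ℝ} [SFinite ν] {m t : ℝ} (ht : t ≤ m) :
    selectedCdf ν ((Iic m).indicator 1) t = (ν (Iic m))⁻¹ * ν (Iic t) := by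
  have hsel : MeasurableSet (selected ((Iic m).indicator 1)) :=
    measurableSet_le measurable_snd
      ((measurable_one.indicator measurableSet_Iic).comp measurable_fst)
  have h1 := unif_prod_selected_inter (ν := ν) m MeasurableSet.univ
  have h2 := unif_prod_selected_inter (ν := ν) m (measurableSet_Iic (a := t))
  simp only [preimage_univ, inter_univ] at h1
  rw [inter_eq_self_of_subset_right (Iic_subset_Iic.2 ht)] at h2
  rw [selectedCdf, cond_apply hsel, h1]
  exact congrArg _ h2

lemma IsSelectivelyDominant.measure_le_mul {Ω Θ : Type*} [MeasurableSpace Ω] {P : Θ → Measure Ω}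
    {H : Set Θ} {p : Ω → ℝ} (h : IsSelectivelyDominant P H p) {θ : Θ} (hθ : θ ∈ H)
    [IsProbabilityMeasure (P θ)] {m : ℝ} (hm : m ∈ Ioc (0 : ℝ) 1) {t : ℝ}
    (ht : t ∈ Icc (0 : ℝ) 1) :
    P θ {ω | p ω ≤ t * m} ≤ ENNReal.ofReal t * P θ {ω | p ω ≤ m} := by
  have hmap : ∀ t, ((P θ).map p) (Iic t) = P θ {ω | p ω ≤ t} := fun t => by
    rw [Measure.map_apply h.measurable measurableSet_Iic]; rfl
  have hsel : IsSelectionFunction ((Iic m).indicator 1) :=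
    ⟨measurable_one.indicator measurableSet_Iic, fun x => by
      by_cases hx : x ≤ m <;> simp [hx]⟩
  have htm : t * m ≤ m := mul_le_of_le_one_left hm.1.le ht.2
  have htm1 : t * m ∈ Icc (0 : ℝ) 1 := ⟨mul_nonneg ht.1 hm.1.le, htm.trans hm.2⟩
  have : SFinite unif := by unfold unif; infer_instance
  have key := h.dominant θ hθ _ hsel (t * m) htm1
  have hm0 : ENNReal.ofReal m ≠ 0 := by simpa using hm.1
  rw [selectedCdf_indicator_Iic htm, selectedCdf_indicator_Iic htm, hmap, hmap, unif_Iic htm1,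
    unif_Iic ⟨hm.1.le, hm.2⟩, ENNReal.ofReal_mul ht.1, mul_comm (ENNReal.ofReal t), ← mul_assoc,
    ENNReal.inv_mul_cancel hm0 ENNReal.ofReal_ne_top, one_mul] at key
  -- If selection has probability zero, `key` carries no information, but both sides vanish.
  rcases eq_or_ne (P θ {ω | p ω ≤ m}) 0 with h0 | h0
  · rw [h0, mul_zero]
    exact (measure_mono_null (fun ω (hω : p ω ≤ t * m) => hω.trans htm) h0).le
  · rw [mul_comm (ENNReal.ofReal t)]
    exact (ENNReal.inv_mul_le_iff h0 (measure_ne_top _ _)).1 key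

/-! ### Ranks and the bottom set -/

section Ranking

variable {Ω : Type*} {n k : ℕ} {p : Fin n → Ω → ℝ} {σ : Ω → Equiv.Perm (Fin n)}

/-- The smallest of the p-values with index in `J`, read as `1` if `J` is empty. -/
noncomputable def minOver (p : Fin n → Ω → ℝ) (J : Finset (Fin n)) (ω : Ω) : ℝ :=
  if h : J.Nonempty then J.inf' h fun i => p i ω else 1

lemma mem_bottom {ω : Ω} {i : Fin n} : i ∈ bottom σ k ω ↔ ((σ ω).symm i : ℕ) < k := by
  simp [bottom]

lemma card_bottom (hkn : k ≤ n) (ω : Ω) : (bottom σ k ω).card = k := by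
  have : bottom σ k ω =
      (Finset.univ.filter fun j : Fin n => (j : ℕ) < k).map (σ ω).toEmbedding := by
    ext i
    simp [mem_bottom, Finset.mem_map_equiv]
  rw [this, Finset.card_map, Fin.card_filter_val_lt, min_eq_right hkn]

lemma prod_orderedP (hkn : k ≤ n) (ω : Ω) :
    ∏ j ∈ Finset.range k, orderedP p σ j ω = ∏ i ∈ bottom σ k ω, p i ω := by
  refine Finset.prod_bij' (fun j hj => σ ω ⟨j, (Finset.mem_range.1 hj).trans_le hkn⟩)
    (fun i _ => ((σ ω).symm i : ℕ)) ?_ ?_ ?_ ?_ ?_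
  · intro j hj
    simpa [mem_bottom] using hj
  · intro i hi
    simpa [mem_bottom] using hi
  · simp
  · simp
  · intro j hj
    simp [orderedP, (Finset.mem_range.1 hj).trans_le hkn]

variable [MeasurableSpace Ω]

lemma IsRanking.orderedP_eq_minOver (hσ : IsRanking p σ) (hkn : k ≤ n) (ω : Ω) :
    orderedP p σ k ω = minOver p (bottom σ k ω)ᶜ ω := by
  rcases hkn.lt_or_eq with h | rfl
  · have hmem : σ ω ⟨k, h⟩ ∈ (bottom σ k ω)ᶜ := by simp [mem_bottom]
    rw [orderedP, dif_pos h, minOver, dif_pos ⟨_, hmem⟩]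
    refine le_antisymm (Finset.le_inf' _ _ fun i hi => ?_) (Finset.inf'_le _ hmem)
    have hi : k ≤ ((σ ω).symm i : ℕ) := by simpa [mem_bottom] using hi
    simpa using hσ.monotone ω (show (⟨k, h⟩ : Fin n) ≤ (σ ω).symm i from hi)
  · have : ¬ ((bottom σ k ω)ᶜ).Nonempty := by
      simp [Finset.not_nonempty_iff_eq_empty, Finset.eq_univ_iff_forall, mem_bottom]
    simp [orderedP, minOver, this]

lemma IsRanking.le_minOver (hσ : IsRanking p σ) (h1 : ∀ i ω, p i ω ≤ 1) {ω : Ω} {i : Fin n}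
    (hi : i ∈ bottom σ k ω) : p i ω ≤ minOver p (bottom σ k ω)ᶜ ω := by
  rw [minOver]
  split_ifs with h
  · refine Finset.le_inf' _ _ fun j hj => ?_
    have hi : ((σ ω).symm i : ℕ) < k := mem_bottom.1 hi
    have hj : k ≤ ((σ ω).symm j : ℕ) := by simpa [mem_bottom] using hj
    simpa using hσ.monotone ω (show (σ ω).symm i ≤ (σ ω).symm j from (hi.trans_le hj).le)
  · exact h1 i ω

/-- Two distinct sets of size `k` differ in both directions, so some `j ∉ I` would be ranked before
some `i ∈ I`, forcing `p j ≤ p i`. Strictness is needed because tie-breaking is arbitrary. -/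
lemma IsRanking.bottom_eq_of_lt_minOver (hσ : IsRanking p σ) (hkn : k ≤ n) {I : Finset (Fin n)}
    (hI : I.card = k) {ω : Ω} (h : Iᶜ.Nonempty → ∀ i ∈ I, p i ω < minOver p Iᶜ ω) :
    bottom σ k ω = I := by
  refine Finset.eq_of_subset_of_card_le (fun j hj => ?_) (by rw [hI, card_bottom hkn])
  by_contra hjI
  have hjI' : j ∈ Iᶜ := Finset.mem_compl.2 hjI
  have hne : Iᶜ.Nonempty := ⟨j, hjI'⟩
  obtain ⟨i, hi, hib⟩ : ∃ i ∈ I, i ∉ bottom σ k ω := by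
    by_contra! hsub
    have := Finset.eq_of_subset_of_card_le hsub (by rw [hI, card_bottom hkn])
    exact hjI (this ▸ hj)
  have h1 := h hne i hi
  rw [minOver, dif_pos hne] at h1
  have h2 : p i ω < p j ω := h1.trans_le (Finset.inf'_le _ hjI')
  have hj : ((σ ω).symm j : ℕ) < k := mem_bottom.1 hj
  have hib : k ≤ ((σ ω).symm i : ℕ) := by simpa [mem_bottom] using hib
  have := hσ.monotone ω (show (σ ω).symm j ≤ (σ ω).symm i from (hj.trans_le hib).le)
  simp only [Equiv.apply_symm_apply] at this
  exact absurd h2 this.not_gt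

lemma IsRanking.measurableSet_bottom_eq (hσ : IsRanking p σ) (I : Finset (Fin n)) :
    MeasurableSet {ω | bottom σ k ω = I} := by
  have : {ω | bottom σ k ω = I} = ⋃ τ ∈ {τ : Equiv.Perm (Fin n) |
      (Finset.univ.filter fun i => (τ.symm i : ℕ) < k) = I}, {ω | σ ω = τ} := by
    ext ω
    simp [bottom]
  rw [this]
  exact MeasurableSet.biUnion (to_countable _) fun τ _ => hσ.measurable τ

/-- Rejection, on the scale of products of p-values. -/
lemma prod_le_of_mem_rejects (hσ : IsRanking p σ) (hkn : k ≤ n) (h0 : ∀ i ω, 0 ≤ p i ω)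
    {α : ℝ} {ω : Ω} (hω : ω ∈ rejects p σ k α) (hm : 0 < minOver p (bottom σ k ω)ᶜ ω) :
    ∏ i ∈ bottom σ k ω, p i ω ≤
      Real.exp (-(1 / 2 * quantile (1 - α) (chiSquared (2 * k)))) *
        minOver p (bottom σ k ω)ᶜ ω ^ k := by
  rw [← prod_orderedP hkn, ← hσ.orderedP_eq_minOver hkn]
  rw [← hσ.orderedP_eq_minOver hkn] at hm
  by_cases hz : ∃ j < k, orderedP p σ j ω = 0
  · obtain ⟨j, hj, hz⟩ := hz
    rw [Finset.prod_eq_zero (Finset.mem_range.2 hj) hz]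
    positivity
  · have hstat : quantile (1 - α) (chiSquared (2 * k)) ≤ statistic p σ k ω := by
      rcases hω with h | h
      · exact absurd h hz
      · exact h
    have hpos : ∀ j ∈ Finset.range k, 0 < orderedP p σ j ω := fun j hj => by
      have hj := Finset.mem_range.1 hj
      refine lt_of_le_of_ne ?_ fun h => hz ⟨j, hj, h.symm⟩
      rw [orderedP, dif_pos (hj.trans_le hkn)]
      exact h0 _ _
    have hprod : 0 < ∏ j ∈ Finset.range k, orderedP p σ j ω / orderedP p σ k ω :=
      Finset.prod_pos fun j hj => div_pos (hpos j hj) hm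
    rw [statistic, ← Real.log_prod fun j hj => (div_pos (hpos j hj) hm).ne'] at hstat
    have := (Real.log_le_iff_le_exp hprod).1 (show _ ≤
      -(1 / 2 * quantile (1 - α) (chiSquared (2 * k))) by linarith)
    rwa [Finset.prod_div_distrib, Finset.prod_const, Finset.card_range,
      div_le_iff₀ (pow_pos hm k)] at this

end Ranking

/-! ### Error control given the bottom set -/

section Conditional

variable {Ω Θ : Type*} [MeasurableSpace Ω] {P : Θ → Measure Ω} {n k : ℕ} {H : Fin n → Set Θ}
  {p : Fin n → Ω → ℝ} {σ : Ω → Equiv.Perm (Fin n)}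

lemma _root_.Finset.measurable_fun_inf' {ι δ : Type*} [MeasurableSpace δ] {s : Finset ι}
    (hs : s.Nonempty) {f : ι → δ → ℝ} (hf : ∀ i ∈ s, Measurable (f i)) :
    Measurable fun x => s.inf' hs fun i => f i x := by
  have := Finset.inf'_induction (p := Measurable) hs f (fun _ h1 _ h2 => h1.inf h2) hf
  convert this using 1
  ext x
  rw [Finset.inf'_apply]

lemma measurable_minOver (hp : ∀ i, Measurable (p i)) (J : Finset (Fin n)) :
    Measurable (minOver p J) := by
  unfold minOver
  by_cases h : J.Nonempty
  · simp only [h, dite_true]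
    exact Finset.measurable_fun_inf' h fun i _ => hp i
  · simp only [h, dite_false]
    exact measurable_const

lemma indepFun_minOver {μ : Measure Ω} [IsProbabilityMeasure μ] (hp : ∀ i, Measurable (p i))
    (hind : iIndepFun p μ) (I : Finset (Fin n)) :
    IndepFun (fun ω (i : I) => p i ω) (minOver p Iᶜ) μ := by
  rcases Iᶜ.eq_empty_or_nonempty with h | h
  · have : minOver p Iᶜ = fun _ => 1 := by
      ext ω; simp [minOver, h]
    rw [this]
    exact indepFun_const_right _ 1
  · have hm : Measurable fun x : (Iᶜ : Finset (Fin n)) → ℝ =>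
        Finset.univ.inf' (Finset.univ_nonempty_iff.2 h.to_subtype) fun i => x i :=
      Finset.measurable_fun_inf' _ fun i _ => measurable_pi_apply i
    have e : minOver p Iᶜ = (fun x : (Iᶜ : Finset (Fin n)) → ℝ =>
        Finset.univ.inf' (Finset.univ_nonempty_iff.2 h.to_subtype) fun i => x i) ∘
          fun ω i => p i ω := by
      ext ω
      simp only [minOver, h, dite_true, Function.comp_apply]
      refine le_antisymm (Finset.le_inf' _ _ fun i _ => Finset.inf'_le _ i.2) ?_
      exact Finset.le_inf' _ _ fun i hi => Finset.inf'_le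
        (fun i : (Iᶜ : Finset (Fin n)) => p i ω) (Finset.mem_univ ⟨i, hi⟩)
    rw [e]
    exact (hind.indepFun_finset I Iᶜ disjoint_compl_right hp).comp measurable_id hm

lemma _root_.ProbabilityTheory.IndepFun.measure_eq_eq_zero {Ω : Type*} [MeasurableSpace Ω]
    {μ : Measure Ω} [IsProbabilityMeasure μ] {X Y : Ω → ℝ} (h : IndepFun X Y μ)
    (hX : Measurable X) (hY : Measurable Y) (hpdf : HasPDF X μ volume) :
    μ {ω | X ω = Y ω} = 0 := by
  have hS : MeasurableSet {z : ℝ × ℝ | z.1 = z.2} :=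
    measurableSet_eq_fun measurable_fst measurable_snd
  refine (h.measure_setOf_eq_lintegral hX hY hS).trans
    ((lintegral_congr fun y => ?_).trans lintegral_zero)
  have hac : μ.map X ≪ volume := HasPDF.absolutelyContinuous
  have h1 : (μ.map X) {y} = 0 := hac Real.volume_singleton
  rw [Measure.map_apply hX (measurableSet_singleton y)] at h1
  exact h1

/-- Only `p i` needs a density: the minimum is independent of it and may have atoms. -/
lemma measure_eq_minOver_eq_zero {μ : Measure Ω} [IsProbabilityMeasure μ]
    (hp : ∀ i, Measurable (p i)) (hind : iIndepFun p μ) {I : Finset (Fin n)} {i : Fin n}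
    (hi : i ∈ I) (hpdf : HasPDF (p i) μ volume) : μ {ω | p i ω = minOver p Iᶜ ω} = 0 := by
  have hc : Measurable fun x : I → ℝ => x ⟨i, hi⟩ :=
    measurable_pi_apply (X := fun _ : I => ℝ) ⟨i, hi⟩
  have hI := (indepFun_minOver hp hind I).comp hc measurable_id
  exact hI.measure_eq_eq_zero (hp i) (measurable_minOver hp _) hpdf

lemma measure_bottom_eq_inter_rejects_le (hdom : ∀ i, IsSelectivelyDominant P (H i) (p i))
    {θ : Θ} [IsProbabilityMeasure (P θ)] (hind : iIndepFun p (P θ)) (hσ : IsRanking p σ)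
    (hk : 1 ≤ k) (hkn : k ≤ n) {α : ℝ} (hα : α ∈ Ioo (0 : ℝ) 1) {I : Finset (Fin n)}
    (hI : ∀ i ∈ I, θ ∈ H i) :
    P θ ({ω | bottom σ k ω = I} ∩ rejects p σ k α) ≤
      ENNReal.ofReal α * P θ {ω | bottom σ k ω = I} := by
  by_cases hcard : I.card = k
  swap
  · have : {ω | bottom σ k ω = I} = ∅ := by
      ext ω
      simp only [mem_ofPred_eq, mem_empty_iff_false, iff_false]
      rintro rfl
      exact hcard (card_bottom hkn ω)
    simp [this]
  have hp := fun i => (hdom i).measurable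
  have h0 : ∀ i ω, 0 ≤ p i ω := fun i ω => ((hdom i).mem_Icc ω).1
  have h1 : ∀ i ω, p i ω ≤ 1 := fun i ω => ((hdom i).mem_Icc ω).2
  set r := Real.exp (-(1 / 2 * quantile (1 - α) (chiSquared (2 * k)))) with hr
  have hM := measurable_minOver hp Iᶜ
  have hX : Measurable fun ω (i : I) => p i ω := measurable_pi_lambda _ fun i => hp i
  have hindM := indepFun_minOver hp hind I
  have hM1 : ∀ ω, minOver p Iᶜ ω ≤ 1 := fun ω => by
    rw [minOver]
    split_ifs with h
    · obtain ⟨j, hj⟩ := h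
      exact (Finset.inf'_le _ hj).trans (h1 j ω)
    · exact le_rfl
  have hcoord : ∀ i : I, Measurable fun z : (I → ℝ) × ℝ => z.1 i := fun i =>
    (measurable_pi_apply i).comp measurable_fst
  -- Evaluated at the p-values in `I` and `M`, `A` stands for `J = I`, and `B` for `J = I` together
  -- with rejection. Almost surely, only `J = I` and rejection implies `B`, and `A` implies `J = I`,
  -- are needed.
  let A : Set ((I → ℝ) × ℝ) := {z | ∀ i, z.1 i ≤ z.2}
  let B : Set ((I → ℝ) × ℝ) := {z | z ∈ A ∧ (0 < z.2 ∧ ∏ i, z.1 i ≤ r * z.2 ^ k)}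
  have hA : MeasurableSet A := by
    change MeasurableSet {z : (I → ℝ) × ℝ | ∀ i, z.1 i ≤ z.2}
    rw [ofPred_forall]
    exact MeasurableSet.iInter fun i => measurableSet_le (hcoord i) measurable_snd
  have hB : MeasurableSet B := by
    refine hA.inter (MeasurableSet.inter ?_ ?_)
    · exact measurableSet_lt measurable_const measurable_snd
    · exact measurableSet_le (Finset.measurable_fun_prod _ fun i _ => hcoord i)
        ((measurable_snd.pow_const k).const_mul r)
  have hmem : ∀ ω y, ((fun i : I => p i ω), y) ∈ A ↔ ∀ i ∈ I, p i ω ≤ y := fun ω y => by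
    simp [A]
  -- Off a null set, the bottom `k` p-values are positive and not tied with the others.
  have hties : ∀ᵐ ω ∂(P θ), ∀ i ∈ I, p i ω ≠ minOver p Iᶜ ω ∧ 0 < p i ω := by
    refine (Finset.eventually_all I).2 fun i hi => Filter.Eventually.and ?_ ?_
    · rw [ae_iff]
      simpa using measure_eq_minOver_eq_zero hp hind hi ((hdom i).hasPDF θ (hI i hi))
    · rw [ae_iff]
      simpa using (hdom i).valid θ (hI i hi) 0 (by simp)
  have hsub : P θ ({ω | bottom σ k ω = I} ∩ rejects p σ k α) ≤
      P θ {ω | ((fun i : I => p i ω), minOver p Iᶜ ω) ∈ B} := by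
    refine measure_mono_ae ?_
    filter_upwards [hties] with ω hω h
    obtain ⟨hb, hrej⟩ := h
    have hb : bottom σ k ω = I := hb
    have hle : ∀ i ∈ I, p i ω ≤ minOver p Iᶜ ω := fun i hi => by
      have := hσ.le_minOver (k := k) h1 (ω := ω) (i := i) (hb ▸ hi)
      rwa [hb] at this
    obtain ⟨i, hi⟩ : I.Nonempty := Finset.card_pos.1 (by omega)
    have hpos : 0 < minOver p Iᶜ ω := (hω i hi).2.trans_le (hle i hi)
    have hprod := prod_le_of_mem_rejects hσ hkn h0 hrej (by rwa [hb])
    rw [hb] at hprod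
    refine ⟨(hmem ω _).2 hle, hpos, ?_⟩
    change ∏ i : I, p i ω ≤ _
    rwa [Finset.prod_coe_sort I fun i => p i ω]
  have hsup : P θ {ω | ((fun i : I => p i ω), minOver p Iᶜ ω) ∈ A} ≤
      P θ {ω | bottom σ k ω = I} := by
    refine measure_mono_ae ?_
    filter_upwards [hties] with ω hω h
    exact hσ.bottom_eq_of_lt_minOver hkn hcard fun _ i hi =>
      lt_of_le_of_ne ((hmem ω _).1 h i hi) (hω i hi).1
  have hsec : ∀ᵐ y ∂((P θ).map (minOver p Iᶜ)),
      P θ {ω | ((fun i : I => p i ω), y) ∈ B} ≤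
        ENNReal.ofReal α * P θ {ω | ((fun i : I => p i ω), y) ∈ A} := by
    -- The truncation bound from selective dominance requires a level in `(0, 1]`.
    have hy1 : ∀ᵐ y ∂((P θ).map (minOver p Iᶜ)), y ≤ 1 :=
      (ae_map_iff hM.aemeasurable measurableSet_Iic).2 (ae_of_all _ hM1)
    filter_upwards [hy1] with y hy1
    by_cases hy : 0 < y
    · have e1 : {ω | ((fun i : I => p i ω), y) ∈ B} =
          {ω | (∀ i ∈ I, p i ω ≤ y) ∧ ∏ i ∈ I, p i ω ≤ r * y ^ I.card} := by
        ext ω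
        simp only [B, mem_ofPred_eq, hmem, hy, true_and, hcard,
          Finset.prod_coe_sort I fun i => p i ω]
      have e2 : P θ {ω | ((fun i : I => p i ω), y) ∈ A} = ∏ i ∈ I, P θ {ω | p i ω ≤ y} := by
        rw [← hind.meas_biInter (S := I) (s := fun i => {ω | p i ω ≤ y})
          fun i _ => ⟨Iic y, measurableSet_Iic, rfl⟩]
        congr 1
        ext ω
        simp [hmem]
      rw [e1, e2, mul_comm (ENNReal.ofReal α)]
      refine (measure_prod_le_prodTail hp hind hy I (fun i hi t ht =>
        (hdom i).measure_le_mul (hI i hi) ⟨hy, hy1⟩ ht) (r := r) (Real.exp_pos _).le).trans ?_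
      rw [hcard]
      exact mul_le_mul_right (prodTail_exp_quantile_le hk hα) _
    · have : {ω | ((fun i : I => p i ω), y) ∈ B} = ∅ := by
        ext ω
        simp [B, hy]
      simp [this]
  have hAmeas : Measurable fun y => P θ {ω | ((fun i : I => p i ω), y) ∈ A} := by
    have := measurable_measure_prodMk_right (μ := (P θ).map fun ω (i : I) => p i ω) hA
    convert this using 2 with y
    rw [Measure.map_apply hX (hA.preimage measurable_prodMk_right)]
    rfl
  calc _ ≤ P θ {ω | ((fun i : I => p i ω), minOver p Iᶜ ω) ∈ B} := hsub
    _ = ∫⁻ y, P θ {ω | ((fun i : I => p i ω), y) ∈ B} ∂((P θ).map (minOver p Iᶜ)) :=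
        hindM.measure_setOf_eq_lintegral hX hM hB
    _ ≤ _ := lintegral_mono_ae hsec
    _ = ENNReal.ofReal α * P θ {ω | ((fun i : I => p i ω), minOver p Iᶜ ω) ∈ A} := by
        rw [lintegral_const_mul _ hAmeas, hindM.measure_setOf_eq_lintegral hX hM hA]
    _ ≤ _ := mul_le_mul_right hsup _

lemma cond_le_of_measure_inter_le {μ : Measure Ω} [IsFiniteMeasure μ] {B E : Set Ω} {a : ENNReal}
    (hB : MeasurableSet B) (h : μ (B ∩ E) ≤ a * μ B) : cond μ B E ≤ a := by
  rw [cond_apply hB]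
  rcases eq_or_ne (μ B) 0 with h0 | h0
  · simp [measure_mono_null inter_subset_left h0]
  · rw [ENNReal.inv_mul_le_iff h0 (measure_ne_top _ _), mul_comm]
    exact h

/-- Total probability: the events `J = I` partition the space into finitely many measurable pieces.
-/
lemma measure_le_of_forall_bottom {μ : Measure Ω} [IsProbabilityMeasure μ] (hσ : IsRanking p σ)
    {E : Set Ω} {a : ENNReal}
    (h : ∀ I, μ ({ω | bottom σ k ω = I} ∩ E) ≤ a * μ {ω | bottom σ k ω = I}) : μ E ≤ a := by
  have hcover : E = ⋃ I : Finset (Fin n), {ω | bottom σ k ω = I} ∩ E := by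
    ext ω; simp
  have hone : ∑ I : Finset (Fin n), μ {ω | bottom σ k ω = I} = 1 := by
    rw [← measure_biUnion_finset (f := fun I : Finset (Fin n) => {ω | bottom σ k ω = I})
      (fun I _ J _ hIJ => disjoint_left.2 fun ω h1 h2 => hIJ (Eq.trans (Eq.symm h1) h2))
      fun I _ => hσ.measurableSet_bottom_eq I,
      ← measure_univ (μ := μ)]
    congr 1
    ext ω; simp
  calc μ E = μ (⋃ I : Finset (Fin n), {ω | bottom σ k ω = I} ∩ E) := by rw [← hcover]
    _ ≤ ∑ I : Finset (Fin n), μ ({ω | bottom σ k ω = I} ∩ E) := measure_iUnion_fintype_le _ _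
    _ ≤ ∑ I : Finset (Fin n), a * μ {ω | bottom σ k ω = I} := Finset.sum_le_sum fun I _ => h I
    _ = a := by rw [← Finset.mul_sum, hone, mul_one]

lemma measure_bottom_eq_inter_falselyRejects_le
    (hdom : ∀ i, IsSelectivelyDominant P (H i) (p i))
    {θ : Θ} [IsProbabilityMeasure (P θ)] (hind : iIndepFun p (P θ)) (hσ : IsRanking p σ)
    (hk : 1 ≤ k) (hkn : k ≤ n) {α : ℝ} (hα : α ∈ Ioo (0 : ℝ) 1) (I : Finset (Fin n)) :
    P θ ({ω | bottom σ k ω = I} ∩ falselyRejects H p σ k α θ) ≤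
      ENNReal.ofReal α * P θ {ω | bottom σ k ω = I} := by
  by_cases hI : ∀ i ∈ I, θ ∈ H i
  · exact (measure_mono (inter_subset_inter_right _ inter_subset_right)).trans
      (measure_bottom_eq_inter_rejects_le hdom hind hσ hk hkn hα hI)
  · have : {ω | bottom σ k ω = I} ∩ falselyRejects H p σ k α θ = ∅ := by
      rw [eq_empty_iff_forall_notMem]
      rintro ω ⟨hb, hω, -⟩
      have hb : bottom σ k ω = I := hb
      exact hI (by simpa [hb] using hω)
    simp [this]

end Conditional

end TopKFisher

theorem corollary5 {Ω Θ : Type*} [MeasurableSpace Ω]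
    (P : Θ → Measure Ω) (hP : ∀ θ, IsProbabilityMeasure (P θ))
    (n k : ℕ) (hk : 1 ≤ k) (hkn : k ≤ n)
    (H : Fin n → Set Θ) (p : Fin n → Ω → ℝ)
    (hdom : ∀ i, TopKFisher.IsSelectivelyDominant P (H i) (p i))
    (hindep : ∀ θ, iIndepFun p (P θ))
    (σ : Ω → Equiv.Perm (Fin n)) (hσ : TopKFisher.IsRanking p σ)
    (α : ℝ) (hα : α ∈ Ioo (0 : ℝ) 1) :
    -- the data-dependent null: error control given the bottom `k` indices, and marginally
    (∀ θ, ∀ I : Finset (Fin n),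
      cond (P θ) {ω | TopKFisher.bottom σ k ω = I} (TopKFisher.falselyRejects H p σ k α θ)
        ≤ ENNReal.ofReal α) ∧
    (∀ θ, P θ (TopKFisher.falselyRejects H p σ k α θ) ≤ ENNReal.ofReal α) ∧
    -- the global null: error control given the bottom `k` indices, and marginally
    (∀ θ ∈ ⋂ i, H i, ∀ I : Finset (Fin n),
      cond (P θ) {ω | TopKFisher.bottom σ k ω = I} (TopKFisher.rejects p σ k α)
        ≤ ENNReal.ofReal α) ∧
    (∀ θ ∈ ⋂ i, H i, P θ (TopKFisher.rejects p σ k α) ≤ ENNReal.ofReal α) := by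
  have hdata := fun θ I => TopKFisher.measure_bottom_eq_inter_falselyRejects_le hdom (hindep θ)
    hσ hk hkn hα I
  have hglobal := fun θ (hθ : θ ∈ ⋂ i, H i) I =>
    TopKFisher.measure_bottom_eq_inter_rejects_le hdom (hindep θ) hσ hk hkn hα (I := I)
      fun i _ => mem_iInter.1 hθ i
  exact ⟨fun θ I => TopKFisher.cond_le_of_measure_inter_le (hσ.measurableSet_bottom_eq I)
      (hdata θ I),
    fun θ => TopKFisher.measure_le_of_forall_bottom hσ (hdata θ),
    fun θ hθ I => TopKFisher.cond_le_of_measure_inter_le (hσ.measurableSet_bottom_eq I)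
      (hglobal θ hθ I),
    fun θ hθ => TopKFisher.measure_le_of_forall_bottom hσ (hglobal θ hθ)⟩
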